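/- **Proposition 1.8.** For a finite Borel measure $\mu$ on $\mathbb R$ put $\widehat\mu(t)=\int_{\mathbb R}e^{-itx}\,d\mu(x)$, and for $\varphi\in L^1(\mathbb R)$ put $\widehat\varphi(t)=\int_{\mathbb R}e^{-itx}\varphi(x)\,dx$. A characteristic function is a function $g=\widehat\mu$ with $\mu$ a probability measure on $\mathbb R$. The essential support $S_\varphi$ of a measurable $\varphi:\mathbb R\to\mathbb R$ is the set of all $x$ such that $(x-\varepsilon,x+\varepsilon)\cap\{\varphi\neq0\}$ has positive Lebesgue measure for every $\varepsilon>0$. Let $\sigma>0$ and $\alpha\in\mathbb R$, and consider the continuous probability densities $\varphi$ on $\mathbb R$ such that $$\{x\in\mathbb R:\varphi(x)\neq0\}=\Bigl(\alpha,\alpha+\frac{2\pi}{\sigma}\Bigr),\qquad S_\varphi=\Bigl[\alpha,\alpha+\frac{2\pi}{\sigma}\Bigr].$$ (i) There exists such a $\varphi$ with the following property: every characteristic function $g:\mathbb R\to\mathbb C$ with $g(t)=\widehat\varphi(t)$ for all $|t|>\sigma$ satisfies $g(t)=\widehat\varphi(t)$ for all $t\in\mathbb R$. (ii) There exist such a $\varphi$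 and a characteristic function $g:\mathbb R\to\mathbb C$ such that $g(t)=\widehat\varphi(t)$ for all $|t|>\sigma$, but $g(t)\neq\widehat\varphi(t)$ for some $t\in\mathbb R$. -/

import Mathlib

/-- The Fourier transform `t ↦ ∫ exp (-i t x) dμ(x)` of a measure on the real line
(the sign convention is opposite to that of `MeasureTheory.charFun`). -/
noncomputable def measureFourier (μ : MeasureTheory.Measure ℝ) (t : ℝ) : ℂ :=
  ∫ x : ℝ, Complex.exp (-(Complex.I * (t : ℂ) * (x : ℂ))) ∂μ

/-- The Fourier transform `t ↦ ∫ exp (-i t x) φ(x) dx` of a function on the real line. -/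
noncomputable def functionFourier (φ : ℝ → ℝ) (t : ℝ) : ℂ :=
  ∫ x : ℝ, Complex.exp (-(Complex.I * (t : ℂ) * (x : ℂ))) * (φ x : ℂ)

/-- `g` is the characteristic function of some probability measure on the real line. -/
def IsCharacteristicFunction (g : ℝ → ℂ) : Prop :=
  ∃ μ : MeasureTheory.Measure ℝ, MeasureTheory.IsProbabilityMeasure μ ∧
    ∀ t : ℝ, g t = measureFourier μ t

/-- `φ` is a probability density with respect to Lebesgue measure. -/
structure IsProbabilityDensity (φ : ℝ → ℝ) : Prop where
  measurable : Measurable φ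
  integrable : MeasureTheory.Integrable φ
  nonneg : ∀ᵐ x : ℝ, 0 ≤ φ x
  integral_eq_one : ∫ x : ℝ, φ x = 1

/-- The essential support: the points all of whose neighbourhoods meet `{φ ≠ 0}` in a set of
positive Lebesgue measure. -/
def essentialSupport (φ : ℝ → ℝ) : Set ℝ :=
  {x | ∀ ε : ℝ, 0 < ε →
    0 < MeasureTheory.volume (Set.Ioo (x - ε) (x + ε) ∩ {t : ℝ | 0 < |φ t|})}

/-- `φ` is a continuous probability density which is nonzero precisely on the open interval
`(a, b)` and whose essential support is the closed interval `[a, b]`. -/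
structure IsDensityOnInterval (a b : ℝ) (φ : ℝ → ℝ) : Prop where
  density : IsProbabilityDensity φ
  continuous : Continuous φ
  ne_zero_iff : ∀ x : ℝ, φ x ≠ 0 ↔ x ∈ Set.Ioo a b
  essentialSupport_eq : essentialSupport φ = Set.Icc a b

/-!
Write `L = 2π/σ` for the length of the interval. If a characteristic function agrees with the
transform of `φ` for `|t| > σ`, then its measure is `(φ + h) dx`, where `h` is real, has spectrum in
`[-σ, σ]` and has integral zero. Since `φ` vanishes outside the interval, `h ≥ 0` there, in
particular on the lattice `α + Lℤ`. The lattice has exactly the critical density for the quadrature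
formula `∑ h (α + kL) = L⁻¹ ∫ h = 0`, so `h` vanishes on it (`samples_eq_zero_of_nonneg`). At every
lattice point other than the two endpoints of the interval `h` has a double zero, and what happens
at the endpoints depends on how fast `φ` vanishes there.

* If `φ` vanishes to second order, then `φ + h ≥ 0` forces double zeros of `h` at the endpoints as
  well, and a function of this bandwidth with double zeros on the lattice is zero
  (`eq_zero_of_double_samples`). So `((x - α)(α + L - x))₊²`, normalised, is determined.
* If `φ` vanishes to first order, there is room for a multiple of
  `h x = sin² (σ(x - α)/2) / ((x - α)(x - α - L))`, which is negative exactly on the interval. Taking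
  for `φ` the normalised negative part of `h`, the positive part of `h` is another density
  whose transform differs from that of `φ` only on `(-σ, σ)`. Here `h` is obtained as the transform
  of the explicit function `sineTent`, up to sign and an affine change of variable.

The function `h` in the uniqueness part is only ever the inversion integral over `[-σ, σ]` of the
difference of the transforms; that `φ + h` is nonnegative follows from Gaussian regularisation
(`inversion_add_density_nonneg`), so that neither absolute continuity of the measure nor
integrability of `h` has to be established.
-/

open Complex MeasureTheory Filter Topology

/-! ### Fourier coefficients of continuous functions -/

/-- A continuous `T`-periodic function (given on one period `[0, T]`) all of whose Fourier
coefficients vanish is zero: its Fourier series is trivially summable. -/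
theorem eq_zero_of_fourier_integrals_eq_zero {T : ℝ} (hT : 0 < T) {F : ℝ → ℂ}
    (hF : Continuous F) (hper : F 0 = F T)
    (hcoef : ∀ k : ℤ, ∫ t in (0 : ℝ)..T, cexp (2 * Real.pi * I * k * t / T) * F t = 0) :
    ∀ t ∈ Set.Icc 0 T, F t = 0 := by
  have : Fact (0 < T) := ⟨hT⟩
  let f : C(AddCircle T, ℂ) := ⟨AddCircle.liftIco T 0 F,
    AddCircle.liftIco_continuous (by simpa using hper) hF.continuousOn⟩
  have hc : ∀ k : ℤ, fourierCoeff f k = 0 := by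
    intro k
    change fourierCoeff (AddCircle.liftIco T 0 F) k = 0
    rw [fourierCoeff_liftIco_eq, fourierCoeffOn_eq_integral, ← hcoef (-k)]
    simp only [zero_add, sub_zero, fourier_coe_apply, smul_eq_mul, hcoef, smul_zero]
  have hIco : ∀ t ∈ Set.Ico 0 T, F t = 0 := by
    intro t ht
    have hs : Summable (fourierCoeff f) := by
      rw [show fourierCoeff (f : AddCircle T → ℂ) = 0 from funext hc]; exact summable_zero
    have h := has_pointwise_sum_fourier_series_of_summable hs (t : AddCircle T)
    simp only [hc, zero_smul] at h
    have h2 := h.unique hasSum_zero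
    have h3 : f (t : AddCircle T) = F t := AddCircle.liftIco_coe_apply (by simpa using ht)
    rw [← h3, h2]
  intro t ht
  rcases ht.2.eq_or_lt with h | h
  · rw [h, ← hper]; exact hIco 0 ⟨le_rfl, hT⟩
  · exact hIco t ⟨ht.1, h⟩

/-- The value `b j` occurs `N - j` times in the `N × N` Toeplitz array `b (m - n)`. -/
theorem sub_mul_le_sum_sum_sub {b : ℤ → ℝ} (hb : ∀ k, 0 ≤ b k) (N j : ℕ) :
    ((N : ℝ) - j) * b j ≤ ∑ m ∈ Finset.range N, ∑ n ∈ Finset.range N, b ((m : ℤ) - n) := by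
  rcases le_or_gt N j with h | h
  · have h1 : ((N : ℝ) - j) * b j ≤ 0 :=
      mul_nonpos_of_nonpos_of_nonneg (by simpa using h) (hb _)
    exact h1.trans (Finset.sum_nonneg fun _ _ => Finset.sum_nonneg fun _ _ => hb _)
  · calc ((N : ℝ) - j) * b j = ∑ n ∈ Finset.range (N - j), b (((n + j : ℕ) : ℤ) - n) := by
          simp [Nat.cast_sub h.le]
      _ ≤ ∑ n ∈ Finset.range (N - j), ∑ m ∈ Finset.range N, b ((m : ℤ) - n) := by
          refine Finset.sum_le_sum fun n hn => ?_
          exact Finset.single_le_sum (f := fun m : ℕ => b ((m : ℤ) - n)) (fun _ _ => hb _)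
            (Finset.mem_range.2 (by have := Finset.mem_range.1 hn; omega))
      _ ≤ ∑ n ∈ Finset.range N, ∑ m ∈ Finset.range N, b ((m : ℤ) - n) :=
          Finset.sum_le_sum_of_subset_of_nonneg
            (Finset.range_subset_range.2 (Nat.sub_le _ _))
            (fun _ _ _ => Finset.sum_nonneg fun _ _ => hb _)
      _ = _ := Finset.sum_comm

/-- A continuous function vanishing at the ends of a period is at most `ε` plus a multiple of
`|1 - e^{2πit/T}|²`. Against the Fejér kernel this replaces the usual splitting of the
integral: the factor `|1 - e^{2πit/T}|²` turns the kernel into a bounded function. -/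
theorem exists_norm_le_add_mul_norm_one_sub_exp_sq {T : ℝ} (hT : 0 < T) {F : ℝ → ℂ}
    (hF : Continuous F) (h0 : F 0 = 0) (h1 : F T = 0) {ε : ℝ} (hε : 0 < ε) :
    ∃ C : ℝ, 0 ≤ C ∧ ∀ t ∈ Set.Icc 0 T,
      ‖F t‖ ≤ ε + C * ‖1 - cexp (2 * Real.pi * I * t / T)‖ ^ 2 := by
  let K : Set ℝ := Set.Icc 0 T ∩ {t | ε ≤ ‖F t‖}
  have hK : IsCompact K := isCompact_Icc.inter_right (isClosed_le continuous_const hF.norm)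
  have hne : ∀ t ∈ K, 1 - cexp (2 * Real.pi * I * t / T) ≠ 0 := by
    rintro t ⟨ht, hFt⟩ h
    rw [sub_eq_zero, eq_comm, Complex.exp_eq_one_iff] at h
    obtain ⟨n, hn⟩ := h
    have hT' : (T : ℂ) ≠ 0 := by exact_mod_cast hT.ne'
    have h2 : (t : ℂ) = n * T := by
      have := Complex.two_pi_I_ne_zero
      field_simp at hn
      linear_combination hn
    have h3 : t = n * T := by exact_mod_cast h2
    have hn0 : (0 : ℝ) ≤ n := by
      by_contra hc; push Not at hc
      nlinarith [ht.1]
    have hn1 : (n : ℝ) ≤ 1 := by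
      by_contra hc; push Not at hc
      nlinarith [ht.2]
    have hFpos : 0 < ‖F t‖ := hε.trans_le hFt
    have : n = 0 ∨ n = 1 := by
      have h4 : (0 : ℤ) ≤ n := by exact_mod_cast hn0
      have h5 : n ≤ (1 : ℤ) := by exact_mod_cast hn1
      omega
    rcases this with rfl | rfl <;> simp at h3 <;> simp [h3, h0, h1] at hFpos
  have hcont : ContinuousOn (fun t : ℝ => ‖F t‖ / ‖1 - cexp (2 * Real.pi * I * t / T)‖ ^ 2) K := by
    refine ContinuousOn.div (by fun_prop) (by fun_prop) fun t ht => ?_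
    exact pow_ne_zero _ (norm_ne_zero_iff.2 (hne t ht))
  obtain ⟨C, hC⟩ := hK.bddAbove_image hcont
  refine ⟨max C 0, le_max_right _ _, fun t ht => ?_⟩
  by_cases hFt : ε ≤ ‖F t‖
  · have htK : t ∈ K := ⟨ht, hFt⟩
    have h2 := hC ⟨t, htK, rfl⟩
    have hpos : 0 < ‖1 - cexp (2 * Real.pi * I * t / T)‖ ^ 2 :=
      pow_pos (norm_pos_iff.2 (hne t htK)) 2
    rw [div_le_iff₀ hpos] at h2
    nlinarith [le_max_left C 0]
  · push Not at hFt
    have : 0 ≤ max C 0 * ‖1 - cexp (2 * Real.pi * I * t / T)‖ ^ 2 := by positivity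
    linarith

/-- `N` times the Fejér kernel, as a trigonometric polynomial. -/
theorem norm_sum_range_exp_sq (N : ℕ) (T t : ℝ) :
    ((‖∑ n ∈ Finset.range N, cexp (2 * Real.pi * I * t / T) ^ n‖ ^ 2 : ℝ) : ℂ)
      = ∑ m ∈ Finset.range N, ∑ n ∈ Finset.range N,
          cexp (2 * Real.pi * I * ((m : ℤ) - (n : ℤ) : ℤ) * t / T) := by
  rw [← Complex.normSq_eq_norm_sq, ← Complex.mul_conj, map_sum, Finset.sum_mul_sum]
  refine Finset.sum_congr rfl fun m _ => Finset.sum_congr rfl fun n _ => ?_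
  rw [map_pow, ← Complex.exp_conj, ← Complex.exp_nat_mul, ← Complex.exp_nat_mul, ← Complex.exp_add]
  congr 1
  simp [map_ofNat]
  ring

theorem integral_exp_two_pi_int {T : ℝ} (hT : 0 < T) (k : ℤ) :
    ∫ t in (0 : ℝ)..T, cexp (2 * Real.pi * I * k * t / T) = if k = 0 then (T : ℂ) else 0 := by
  have hT' : (T : ℂ) ≠ 0 := by exact_mod_cast hT.ne'
  split_ifs with h
  · simp [h]
  · have hc : (2 * Real.pi * I * k / T : ℂ) ≠ 0 := by
      have := Complex.two_pi_I_ne_zero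
      have : (k : ℂ) ≠ 0 := by exact_mod_cast h
      positivity
    have h2 := integral_exp_mul_complex (a := 0) (b := T) hc
    have h3 : ∀ t : ℝ, (2 * Real.pi * I * k * t / T : ℂ) = 2 * Real.pi * I * k / T * t := by
      intro t; ring
    simp_rw [h3]
    rw [h2]
    have h4 : (2 * Real.pi * I * k / T * T : ℂ) = k * (2 * Real.pi * I) := by field_simp
    rw [h4, Complex.exp_int_mul_two_pi_mul_I]
    simp

/-- If a continuous periodic function vanishes at `0` and has nonnegative Fourier coefficients,
then all of these vanish: formally their sum is the value at `0`, and the Fejér means at `0`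
make this rigorous without summability. -/
theorem fourier_integrals_eq_zero_of_nonneg {T : ℝ} (hT : 0 < T) {F : ℝ → ℂ} (hF : Continuous F)
    (h0 : F 0 = 0) (h1 : F T = 0) {b : ℤ → ℝ} (hb : ∀ k, 0 ≤ b k)
    (hcoef : ∀ k : ℤ, ∫ t in (0 : ℝ)..T, cexp (2 * Real.pi * I * k * t / T) * F t = b k) :
    ∀ k, b k = 0 := by
  have key : ∀ ε : ℝ, 0 < ε → ∃ M : ℝ, ∀ N : ℕ,
      ∑ m ∈ Finset.range N, ∑ n ∈ Finset.range N, b ((m : ℤ) - n) ≤ ε * N + M := by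
    intro ε hε
    have hε' : 0 < ε / T := by positivity
    obtain ⟨C, hC0, hC⟩ := exists_norm_le_add_mul_norm_one_sub_exp_sq hT hF h0 h1 hε'
    refine ⟨T * (C * 4), fun N => ?_⟩
    let S : ℝ → ℝ := fun t => ‖∑ n ∈ Finset.range N, cexp (2 * Real.pi * I * t / T) ^ n‖ ^ 2
    have hScont : Continuous S := by fun_prop
    have hSint : ∫ t in (0 : ℝ)..T, S t = N * T := by
      have : ((∫ t in (0 : ℝ)..T, S t : ℝ) : ℂ) = (N * T : ℝ) := by
        rw [← intervalIntegral.integral_ofReal]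
        simp only [S, norm_sum_range_exp_sq]
        rw [intervalIntegral.integral_finsetSum
          (fun m _ => Continuous.intervalIntegrable (by fun_prop) _ _)]
        have : ∀ m ∈ Finset.range N, ∫ t in (0 : ℝ)..T, ∑ n ∈ Finset.range N,
            cexp (2 * Real.pi * I * ((m : ℤ) - (n : ℤ) : ℤ) * t / T) = T := by
          intro m hm
          rw [intervalIntegral.integral_finsetSum
            (fun m _ => Continuous.intervalIntegrable (by fun_prop) _ _)]
          simp_rw [integral_exp_two_pi_int hT, sub_eq_zero, Nat.cast_inj]
          simp [Finset.mem_range.1 hm]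
        rw [Finset.sum_congr rfl this]
        simp
      exact_mod_cast this
    have hsum : ((∑ m ∈ Finset.range N, ∑ n ∈ Finset.range N, b ((m : ℤ) - n) : ℝ) : ℂ)
        = ∫ t in (0 : ℝ)..T, (S t : ℂ) * F t := by
      simp only [S, norm_sum_range_exp_sq, Finset.sum_mul]
      rw [intervalIntegral.integral_finsetSum
        (fun m _ => Continuous.intervalIntegrable (by fun_prop) _ _)]
      simp only [Complex.ofReal_sum]
      refine Finset.sum_congr rfl fun m _ => ?_
      rw [intervalIntegral.integral_finsetSum
        (fun m _ => Continuous.intervalIntegrable (by fun_prop) _ _)]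
      exact Finset.sum_congr rfl fun n _ => (hcoef _).symm
    have hbound : ∀ t ∈ Set.Icc 0 T, ‖(S t : ℂ) * F t‖ ≤ ε / T * S t + C * 4 := by
      intro t ht
      have hS0 : 0 ≤ S t := by positivity
      have hSm : ‖1 - cexp (2 * Real.pi * I * t / T)‖ ^ 2 * S t ≤ 4 := by
        have hnorm : ‖cexp (2 * Real.pi * I * t / T)‖ = 1 := by
          rw [Complex.norm_exp]; simp
        simp only [S]
        rw [← mul_pow, ← norm_mul, mul_neg_geom_sum]
        have : ‖1 - cexp (2 * Real.pi * I * t / T) ^ N‖ ≤ 2 := by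
          refine (norm_sub_le _ _).trans ?_
          rw [norm_pow, hnorm]; norm_num
        nlinarith [norm_nonneg (1 - cexp (2 * Real.pi * I * t / T) ^ N)]
      rw [norm_mul, Complex.norm_real, Real.norm_of_nonneg hS0]
      calc S t * ‖F t‖
          ≤ S t * (ε / T + C * ‖1 - cexp (2 * Real.pi * I * t / T)‖ ^ 2) :=
            mul_le_mul_of_nonneg_left (hC t ht) hS0
        _ = ε / T * S t + C * (‖1 - cexp (2 * Real.pi * I * t / T)‖ ^ 2 * S t) := by ring
        _ ≤ _ := by gcongr
    have hle : ‖∫ t in (0 : ℝ)..T, (S t : ℂ) * F t‖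
        ≤ ∫ t in (0 : ℝ)..T, (ε / T * S t + C * 4) := by
      refine intervalIntegral.norm_integral_le_of_norm_le hT.le ?_
        (Continuous.intervalIntegrable (by fun_prop) _ _)
      exact Eventually.of_forall fun t ht => hbound t ⟨ht.1.le, ht.2⟩
    rw [← hsum, Complex.norm_real] at hle
    refine (le_abs_self _).trans (hle.trans (le_of_eq ?_))
    rw [intervalIntegral.integral_add (Continuous.intervalIntegrable (by fun_prop) _ _)
      (by simp), intervalIntegral.integral_const_mul, hSint]
    simp
    field_simp
  have nat_case : ∀ c : ℤ → ℝ, (∀ k, 0 ≤ c k) → (∀ ε : ℝ, 0 < ε → ∃ M : ℝ, ∀ N : ℕ,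
      ∑ m ∈ Finset.range N, ∑ n ∈ Finset.range N, c ((m : ℤ) - n) ≤ ε * N + M) →
      ∀ j : ℕ, c j = 0 := by
    intro c hc hkey j
    refine le_antisymm (le_of_forall_pos_le_add fun ε hε => ?_) (hc _)
    obtain ⟨M, hM⟩ := hkey ε hε
    by_contra hlt
    push Not at hlt
    rw [zero_add] at hlt
    obtain ⟨N, hN⟩ := exists_nat_gt ((M + j * c j) / (c j - ε))
    rw [div_lt_iff₀ (by linarith)] at hN
    have h1 := (sub_mul_le_sum_sum_sub hc N j).trans (hM N)
    nlinarith
  intro k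
  obtain ⟨n, rfl | rfl⟩ := k.eq_nat_or_neg
  · exact nat_case b hb key n
  · refine nat_case (fun k => b (-k)) (fun k => hb _) (fun ε hε => ?_) n
    obtain ⟨M, hM⟩ := key ε hε
    refine ⟨M, fun N => le_trans (le_of_eq ?_) (hM N)⟩
    rw [Finset.sum_comm]
    simp

/-! ### Functions determined by double sampling -/

/-- Folding `[-T, T]` onto `[0, T]`: the lattice samples of the inverse transform of `G` are the
Fourier coefficients of the periodisation `G t + G (t - T)`. -/
theorem integral_exp_mul_add_translate {T : ℝ} (hT : 0 < T) {G : ℝ → ℂ} (hG : Continuous G)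
    (k : ℤ) :
    ∫ t in (0 : ℝ)..T, cexp (2 * Real.pi * I * k * t / T) * (G t + G (t - T)) =
      ∫ t in (-T)..T, cexp (2 * Real.pi * I * k * t / T) * G t := by
  have hT' : (T : ℂ) ≠ 0 := by exact_mod_cast hT.ne'
  have hi : ∀ a b, IntervalIntegrable
      (fun t : ℝ => cexp (2 * Real.pi * I * k * t / T) * G t) volume a b :=
    fun a b => Continuous.intervalIntegrable (by fun_prop) _ _
  have h1 : ∫ t in (0 : ℝ)..T, cexp (2 * Real.pi * I * k * t / T) * G (t - T) =
      ∫ t in (-T)..0, cexp (2 * Real.pi * I * k * t / T) * G t := by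
    have := intervalIntegral.integral_comp_sub_right (a := 0) (b := T)
      (fun t : ℝ => cexp (2 * Real.pi * I * k * t / T) * G t) T
    simp only [zero_sub, sub_self] at this
    rw [← this]
    refine intervalIntegral.integral_congr fun t _ => ?_
    have h2 : (2 * Real.pi * I * k * t / T : ℂ)
        = 2 * Real.pi * I * k * ((t - T : ℝ) : ℂ) / T + k * (2 * Real.pi * I) := by
      push_cast
      field_simp
      ring
    rw [h2, Complex.exp_add, Complex.exp_int_mul_two_pi_mul_I, mul_one]
  simp only [mul_add]
  rw [intervalIntegral.integral_add (hi _ _) (Continuous.intervalIntegrable (by fun_prop) _ _), h1,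
    add_comm, intervalIntegral.integral_add_adjacent_intervals (hi _ _) (hi _ _)]

/-- The quadrature formula: nonnegative samples on the lattice of step `2π/T` add up to the
periodisation at `0`, which is zero here. -/
theorem samples_eq_zero_of_nonneg {T : ℝ} (hT : 0 < T) {G : ℝ → ℂ} (hG : Continuous G)
    (h0 : G 0 = 0) (h1 : G T = 0) (h2 : G (-T) = 0) {b : ℤ → ℝ} (hb : ∀ k, 0 ≤ b k)
    (hcoef : ∀ k : ℤ, ∫ t in (-T)..T, cexp (2 * Real.pi * I * k * t / T) * G t = b k) :
    ∀ k, b k = 0 :=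
  fourier_integrals_eq_zero_of_nonneg hT (F := fun t => G t + G (t - T)) (by fun_prop)
    (by simp [h0, h2]) (by simp [h0, h1]) hb
    fun k => (integral_exp_mul_add_translate hT hG k).trans (hcoef k)

/-- A function with spectrum in `[-T, T]` is determined by its values and its derivatives on a
lattice of step `2π/T`. The two periodisations give `G t + G (t - T) = 0` and
`t G t + (t - T) G (t - T) = 0` on `[0, T]`, a linear system of determinant `-T`. -/
theorem eq_zero_of_double_samples {T : ℝ} (hT : 0 < T) {G : ℝ → ℂ} (hG : Continuous G)
    (h1 : G T = 0) (h2 : G (-T) = 0)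
    (hcoef : ∀ k : ℤ, ∫ t in (-T)..T, cexp (2 * Real.pi * I * k * t / T) * G t = 0)
    (hcoef' : ∀ k : ℤ, ∫ t in (-T)..T, cexp (2 * Real.pi * I * k * t / T) * (t * G t) = 0) :
    ∀ t ∈ Set.Icc (-T) T, G t = 0 := by
  have hT' : (T : ℂ) ≠ 0 := by exact_mod_cast hT.ne'
  have hF := eq_zero_of_fourier_integrals_eq_zero hT (F := fun t => G t + G (t - T))
    (by fun_prop) (by simp [h1, h2, add_comm])
    fun k => (integral_exp_mul_add_translate hT hG k).trans (hcoef k)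
  have hF' := eq_zero_of_fourier_integrals_eq_zero hT
    (F := fun t => (t * G t) + ((t - T : ℝ) : ℂ) * G (t - T))
    (by fun_prop) (by simp [h1, h2])
    fun k => (integral_exp_mul_add_translate hT (G := fun t => t * G t) (by fun_prop) k).trans
      (hcoef' k)
  have hpos : ∀ t ∈ Set.Icc 0 T, G t = 0 := by
    intro t ht
    have e1 := hF t ht
    have e2 := hF' t ht
    push_cast at e2
    have : (T : ℂ) * G t = 0 := by linear_combination e2 - (t - T) * e1
    simpa [hT'] using this
  intro t ht
  rcases le_total 0 t with h | h
  · exact hpos t ⟨h, ht.2⟩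
  · have hm : t + T ∈ Set.Icc 0 T := ⟨by linarith [ht.1], by linarith⟩
    have := hF _ hm
    simpa [hpos _ hm] using this

/-! ### Gaussian regularisation of Fourier inversion -/

theorem measureFourier_eq_charFun (μ : Measure ℝ) (t : ℝ) :
    measureFourier μ t = charFun μ (-t) := by
  rw [charFun_apply_real, measureFourier]
  congr with x
  congr 1
  push_cast
  ring

theorem continuous_measureFourier (μ : Measure ℝ) [IsFiniteMeasure μ] :
    Continuous (measureFourier μ) := by
  rw [funext (measureFourier_eq_charFun μ)]
  fun_prop

theorem integral_withDensity_ofReal {φ : ℝ → ℝ} (hm : Measurable φ) (h0 : ∀ᵐ x, 0 ≤ φ x)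
    (f : ℝ → ℂ) :
    ∫ x, f x ∂(volume.withDensity fun x => ENNReal.ofReal (φ x)) = ∫ x, f x * φ x := by
  rw [integral_withDensity_eq_integral_toReal_smul (by fun_prop) (by simp)]
  refine integral_congr_ae ?_
  filter_upwards [h0] with x hx
  rw [ENNReal.toReal_ofReal hx, Complex.real_smul, mul_comm]

theorem IsProbabilityDensity.isProbabilityMeasure {φ : ℝ → ℝ} (h : IsProbabilityDensity φ) :
    IsProbabilityMeasure (volume.withDensity fun x => ENNReal.ofReal (φ x)) := by
  constructor
  rw [withDensity_apply _ MeasurableSet.univ, Measure.restrict_univ,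
    ← ofReal_integral_eq_lintegral_ofReal h.integrable h.nonneg, h.integral_eq_one,
    ENNReal.ofReal_one]

theorem IsProbabilityDensity.functionFourier_eq {φ : ℝ → ℝ} (h : IsProbabilityDensity φ) (t : ℝ) :
    functionFourier φ t = measureFourier (volume.withDensity fun x => ENNReal.ofReal (φ x)) t :=
  (integral_withDensity_ofReal h.measurable h.nonneg _).symm

/-- The Gaussian means of the inverse transform of a finite measure are its convolutions with a
Gaussian. -/
theorem integral_gaussian_mul_measureFourier (μ : Measure ℝ) [IsFiniteMeasure μ] {b : ℝ}
    (hb : 0 < b) (x : ℝ) :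
    ∫ t : ℝ, cexp (-b * t ^ 2) * cexp (I * x * t) * measureFourier μ t =
      ∫ y, (Real.pi / b : ℂ) ^ (1 / 2 : ℂ) * cexp (-(x - y : ℝ) ^ 2 / (4 * b)) ∂μ := by
  have hb' : 0 < (b : ℂ).re := by simpa
  calc ∫ t : ℝ, cexp (-b * t ^ 2) * cexp (I * x * t) * measureFourier μ t
      = ∫ t : ℝ, ∫ y, cexp (-b * t ^ 2) * cexp (I * x * t) * cexp (-(I * t * y)) ∂μ := by
        simp only [measureFourier, integral_const_mul]
    _ = ∫ y, (∫ t : ℝ, cexp (-b * t ^ 2) * cexp (I * x * t) * cexp (-(I * t * y))) ∂μ := by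
        refine integral_integral_swap ?_
        have h1 : Integrable (fun z : ℝ × ℝ => cexp (-b * z.1 ^ 2) * (1 : ℂ))
            ((volume : Measure ℝ).prod μ) :=
          (integrable_cexp_neg_mul_sq hb').mul_prod (integrable_const (1 : ℂ))
        refine h1.mono (by unfold Function.uncurry; fun_prop) (Eventually.of_forall fun z => ?_)
        have e1 : ‖cexp (I * x * z.1)‖ = 1 := by rw [Complex.norm_exp]; simp
        have e2 : ‖cexp (-(I * z.1 * z.2))‖ = 1 := by rw [Complex.norm_exp]; simp
        simp [Function.uncurry, e1, e2]
    _ = _ := by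
        refine integral_congr_ae (Eventually.of_forall fun y => ?_)
        simp only
        have h := fourierIntegral_gaussian hb' ((x - y : ℝ) : ℂ)
        rw [← h]
        refine integral_congr_ae (Eventually.of_forall fun t => ?_)
        simp only
        rw [mul_assoc, mul_comm, ← Complex.exp_add]
        congr 2
        push_cast
        ring

theorem integral_gaussian_mul_measureFourier_nonneg (μ : Measure ℝ) [IsFiniteMeasure μ] {b : ℝ}
    (hb : 0 < b) (x : ℝ) :
    ∫ t : ℝ, cexp (-b * t ^ 2) * cexp (I * x * t) * measureFourier μ t ∈
      {z : ℂ | 0 ≤ z.re ∧ z.im = 0} := by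
  rw [integral_gaussian_mul_measureFourier μ hb]
  have h : ∀ y : ℝ, (Real.pi / b : ℂ) ^ (1 / 2 : ℂ) * cexp (-(x - y : ℝ) ^ 2 / (4 * b)) =
      (((Real.pi / b) ^ (1 / 2 : ℝ) * Real.exp (-(x - y) ^ 2 / (4 * b)) : ℝ) : ℂ) := by
    intro y
    push_cast
    rw [Complex.ofReal_cpow (by positivity)]
    push_cast
    rfl
  simp only [h]
  have h2 := integral_complex_ofReal (μ := μ)
    (f := fun y => (Real.pi / b) ^ (1 / 2 : ℝ) * Real.exp (-(x - y) ^ 2 / (4 * b)))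
  rw [h2]
  exact ⟨by rw [Complex.ofReal_re]; exact integral_nonneg fun y => by positivity,
    Complex.ofReal_im _⟩

/-- The factor `(4π²c)⁻¹` makes the Gaussian on the space side equal to `exp (-π²c |x - y|²)`, the
form of the approximate identity in Mathlib's Fourier inversion. -/
theorem tendsto_integral_gaussian_mul_functionFourier {φ : ℝ → ℝ} (h : IsProbabilityDensity φ)
    (hc : Continuous φ) (x : ℝ) :
    Tendsto (fun c : ℝ => ∫ t : ℝ, cexp (-((4 * Real.pi ^ 2 * c)⁻¹ : ℝ) * t ^ 2) *
      cexp (I * x * t) * functionFourier φ t) atTop (𝓝 (2 * Real.pi * φ x)) := by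
  have h1 := (Real.tendsto_integral_gaussian_smul' h.integrable.ofReal (v := x)
    (f := fun y => (φ y : ℂ)) (by fun_prop)).const_mul (2 * Real.pi : ℂ)
  refine h1.congr' ?_
  filter_upwards [eventually_gt_atTop 0] with c hc0
  have := h.isProbabilityMeasure
  simp only [h.functionFourier_eq]
  rw [integral_gaussian_mul_measureFourier _ (by positivity),
    integral_withDensity_ofReal h.measurable h.nonneg, ← integral_const_mul]
  refine integral_congr_ae (Eventually.of_forall fun y => ?_)
  have hpi : (Real.pi : ℂ) ≠ 0 := by exact_mod_cast Real.pi_ne_zero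
  have hcc : (c : ℂ) ≠ 0 := by exact_mod_cast hc0.ne'
  have e1 : (Real.pi / ((4 * Real.pi ^ 2 * c)⁻¹ : ℝ) : ℂ) ^ (1 / 2 : ℂ)
      = 2 * Real.pi * (Real.pi * c) ^ (1 / 2 : ℂ) := by
    have : (Real.pi / ((4 * Real.pi ^ 2 * c)⁻¹ : ℝ) : ℂ)
        = (((2 * Real.pi) ^ 2 : ℝ) : ℂ) * ((Real.pi * c : ℝ) : ℂ) := by
      push_cast; field_simp; norm_num
    rw [this, Complex.mul_cpow_ofReal_nonneg (by positivity) (by positivity)]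
    push_cast
    congr 1
    rw [one_div, Complex.sq_cpow_two_inv (by simpa using Real.pi_pos)]
  simp only [smul_eq_mul, e1, Module.finrank_self, Nat.cast_one]
  have e2 : (-(x - y : ℝ) ^ 2 / (4 * ((4 * Real.pi ^ 2 * c)⁻¹ : ℝ)) : ℂ)
      = -Real.pi ^ 2 * c * (‖x - y‖ : ℝ) ^ 2 := by
    have : ((‖x - y‖ : ℝ) : ℂ) ^ 2 = ((x - y : ℝ) : ℂ) ^ 2 := by
      rw [Real.norm_eq_abs]; exact_mod_cast sq_abs (x - y)
    rw [this]
    push_cast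
    field_simp
  rw [e2]
  ring

/-- If the transforms of a probability measure and of a density agree outside `[-T, T]`, then the
measure has, informally, the continuous density `φ + h`, where `2πh` is the inversion integral of
the difference. All that is used of this is that `h + φ` is real and nonnegative. -/
theorem inversion_add_density_nonneg {φ : ℝ → ℝ} (hφ : IsProbabilityDensity φ)
    (hc : Continuous φ) (μ : Measure ℝ) [IsProbabilityMeasure μ] {T : ℝ} (hT : 0 < T)
    (hD : ∀ t, T ≤ |t| → measureFourier μ t = functionFourier φ t) (x : ℝ) :
    (∫ t in (-T)..T, cexp (I * x * t) * (measureFourier μ t - functionFourier φ t)) +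
      2 * Real.pi * φ x ∈ {z : ℂ | 0 ≤ z.re ∧ z.im = 0} := by
  have := hφ.isProbabilityMeasure
  have hφc : Continuous (functionFourier φ) := by
    rw [funext hφ.functionFourier_eq]; exact continuous_measureFourier _
  have hμc := continuous_measureFourier μ
  have hclosed : IsClosed {z : ℂ | 0 ≤ z.re ∧ z.im = 0} :=
    (isClosed_le continuous_const continuous_re).inter (isClosed_eq continuous_im continuous_const)
  set D : ℝ → ℂ := fun t => measureFourier μ t - functionFourier φ t with hDdef
  have hDc : Continuous D := hμc.sub hφc
  have hlim1 : Tendsto (fun c : ℝ => ∫ t in (-T)..T,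
      cexp (-((4 * Real.pi ^ 2 * c)⁻¹ : ℝ) * t ^ 2) * (cexp (I * x * t) * D t)) atTop
      (𝓝 (∫ t in (-T)..T, cexp (I * x * t) * D t)) := by
    refine intervalIntegral.tendsto_integral_filter_of_dominated_convergence
      (fun t => ‖cexp (I * x * t) * D t‖) ?_ ?_
      (Continuous.intervalIntegrable (by fun_prop) _ _) ?_
    · exact Eventually.of_forall fun c =>
        (by fun_prop : Continuous fun t : ℝ => cexp (-((4 * Real.pi ^ 2 * c)⁻¹ : ℝ) * t ^ 2) *
          (cexp (I * x * t) * D t)).aestronglyMeasurable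
    · filter_upwards [eventually_gt_atTop 0] with c hc0
      refine Eventually.of_forall fun t _ => ?_
      rw [norm_mul]
      refine mul_le_of_le_one_left (norm_nonneg _) ?_
      rw [← Complex.ofReal_neg, ← Complex.ofReal_pow, ← Complex.ofReal_mul, ← Complex.ofReal_exp,
        Complex.norm_real, Real.norm_of_nonneg (Real.exp_pos _).le, Real.exp_le_one_iff]
      have : 0 ≤ (4 * Real.pi ^ 2 * c)⁻¹ * t ^ 2 := by positivity
      linarith
    · refine Eventually.of_forall fun t _ => ?_
      have h1 : Tendsto (fun c : ℝ => (4 * Real.pi ^ 2 * c)⁻¹) atTop (𝓝 0) :=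
        (tendsto_id.const_mul_atTop (by positivity)).inv_tendsto_atTop
      have h2 : Continuous fun s : ℝ => cexp (-(s : ℂ) * t ^ 2) * (cexp (I * x * t) * D t) := by
        fun_prop
      have h3 := (h2.tendsto 0).comp h1
      simpa [Function.comp_def] using h3
  have hlim := hlim1.add (tendsto_integral_gaussian_mul_functionFourier hφ hc x)
  refine hclosed.mem_of_tendsto hlim ?_
  filter_upwards [eventually_gt_atTop 0] with c hc0
  have hb : 0 < (4 * Real.pi ^ 2 * c)⁻¹ := by positivity
  have hDint : ∫ t in (-T)..T,
      cexp (-((4 * Real.pi ^ 2 * c)⁻¹ : ℝ) * t ^ 2) * (cexp (I * x * t) * D t) =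
      ∫ t : ℝ, cexp (-((4 * Real.pi ^ 2 * c)⁻¹ : ℝ) * t ^ 2) * (cexp (I * x * t) * D t) := by
    rw [intervalIntegral.integral_of_le (by linarith)]
    refine setIntegral_eq_integral_of_forall_compl_eq_zero fun t ht => ?_
    have : T ≤ |t| := by
      by_contra hlt
      push Not at hlt
      exact ht ⟨(abs_lt.1 hlt).1, (abs_lt.1 hlt).2.le⟩
    simp [D, hD t this]
  have hg : Integrable fun t : ℝ => cexp (-((4 * Real.pi ^ 2 * c)⁻¹ : ℝ) * t ^ 2) :=
    integrable_cexp_neg_mul_sq (by rwa [Complex.ofReal_re])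
  have hbdd : ∀ ν : Measure ℝ, IsProbabilityMeasure ν → Integrable fun t : ℝ =>
      cexp (-((4 * Real.pi ^ 2 * c)⁻¹ : ℝ) * t ^ 2) * cexp (I * x * t) * measureFourier ν t := by
    intro ν hν
    have hν' := continuous_measureFourier ν
    refine hg.mono (by fun_prop) (Eventually.of_forall fun t => ?_)
    have e1 : ‖cexp (I * x * t)‖ = 1 := by rw [Complex.norm_exp]; simp
    rw [norm_mul, norm_mul, e1, mul_one, measureFourier_eq_charFun]
    exact mul_le_of_le_one_right (norm_nonneg _) (norm_charFun_le_one _)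
  have hμi := hbdd μ inferInstance
  have hφi := hbdd _ this
  simp only [← hφ.functionFourier_eq] at hφi
  have hDi : Integrable fun t : ℝ =>
      cexp (-((4 * Real.pi ^ 2 * c)⁻¹ : ℝ) * t ^ 2) * (cexp (I * x * t) * D t) :=
    (hμi.sub hφi).congr (Eventually.of_forall fun t => by simp only [D, Pi.sub_apply]; ring)
  have hsum : (∫ t in (-T)..T,
        cexp (-((4 * Real.pi ^ 2 * c)⁻¹ : ℝ) * t ^ 2) * (cexp (I * x * t) * D t)) +
      ∫ t : ℝ, cexp (-((4 * Real.pi ^ 2 * c)⁻¹ : ℝ) * t ^ 2) * cexp (I * x * t) *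
        functionFourier φ t =
      ∫ t : ℝ, cexp (-((4 * Real.pi ^ 2 * c)⁻¹ : ℝ) * t ^ 2) * cexp (I * x * t) *
        measureFourier μ t := by
    rw [hDint, ← integral_add hDi hφi]
    refine integral_congr_ae (Eventually.of_forall fun t => ?_)
    simp only [D]
    ring
  rw [hsum]
  exact integral_gaussian_mul_measureFourier_nonneg μ hb x

/-! ### Uniqueness for a density with double zeros on a lattice -/

theorem hasDerivAt_integral_exp_mul {T : ℝ} {D : ℝ → ℂ} (hD : Continuous D) (x : ℝ) :
    HasDerivAt (fun x : ℝ => ∫ t in (-T)..T, cexp (I * x * t) * D t)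
      (∫ t in (-T)..T, I * (cexp (I * x * t) * (t * D t))) x := by
  refine (intervalIntegral.hasDerivAt_integral_of_dominated_loc_of_deriv_le (s := Set.univ)
    (F' := fun (x : ℝ) (t : ℝ) => I * (cexp (I * x * t) * (t * D t)))
    (bound := fun t => ‖(t : ℂ) * D t‖) Filter.univ_mem ?_ ?_ ?_ ?_ ?_ ?_).2
  · exact Eventually.of_forall fun y =>
      (by fun_prop : Continuous fun t : ℝ => cexp (I * y * t) * D t).aestronglyMeasurable
  · exact Continuous.intervalIntegrable (by fun_prop) _ _
  · exact (by fun_prop : Continuous fun t : ℝ =>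
      I * (cexp (I * x * t) * (t * D t))).aestronglyMeasurable
  · refine Eventually.of_forall fun t _ y _ => ?_
    have e1 : ‖cexp (I * y * t)‖ = 1 := by rw [Complex.norm_exp]; simp
    rw [norm_mul, norm_mul, e1, Complex.norm_I, one_mul, one_mul]
  · exact Continuous.intervalIntegrable (by fun_prop) _ _
  · refine Eventually.of_forall fun t _ y _ => ?_
    have h1 : HasDerivAt (fun y : ℝ => I * (y : ℂ) * t) (I * 1 * t) y :=
      ((Complex.ofRealCLM.hasDerivAt (x := y)).const_mul I).mul_const (t : ℂ)
    have h2 := (h1.cexp).mul_const (D t)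
    have e2 : I * (cexp (I * y * t) * (t * D t)) = cexp (I * y * t) * (I * 1 * t) * D t := by
      ring
    rw [e2]
    exact h2

/-- A density with zeros of order two at all points `α + 2πk/σ` is determined among probability
measures by its transform outside `[-σ, σ]`.
The difference `h` of the densities, scaled by `2π`, is nonnegative at the lattice points, so it vanishes there by
the quadrature formula. Then `h` plus a multiple of `(x - (α + 2πk/σ))²` has a minimum at each
lattice point, so the derivative of `h` vanishes there too, and `h = 0`. -/
theorem measureFourier_eq_of_density_le_sq {σ α : ℝ} (hσ : 0 < σ) {φ : ℝ → ℝ}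
    (hφ : IsProbabilityDensity φ) (hc : Continuous φ) {C : ℝ}
    (hC : ∀ (k : ℤ) (x : ℝ), φ x ≤ C * (x - (α + 2 * Real.pi * k / σ)) ^ 2)
    (μ : Measure ℝ) [IsProbabilityMeasure μ]
    (hμ : ∀ t, σ < |t| → functionFourier φ t = measureFourier μ t) (t : ℝ) :
    functionFourier φ t = measureFourier μ t := by
  have := hφ.isProbabilityMeasure
  have hφc : Continuous (functionFourier φ) := by
    rw [funext hφ.functionFourier_eq]; exact continuous_measureFourier _
  have hμc := continuous_measureFourier μ
  have hμ' : ∀ t, σ ≤ |t| → measureFourier μ t = functionFourier φ t := by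
    intro t ht
    rcases le_abs.1 ht with h | h
    · have := Set.EqOn.closure (s := Set.Ioi σ) (f := functionFourier φ) (g := measureFourier μ)
        (fun s hs => hμ s (lt_abs.2 (Or.inl hs))) hφc hμc
      rw [closure_Ioi] at this
      exact (this h).symm
    · have := Set.EqOn.closure (s := Set.Iio (-σ)) (f := functionFourier φ) (g := measureFourier μ)
        (fun s hs => hμ s (lt_abs.2 (Or.inr (by rw [Set.mem_Iio] at hs; linarith)))) hφc hμc
      rw [closure_Iio] at this
      exact (this (by rw [Set.mem_Iic]; linarith)).symm
  have hpos := inversion_add_density_nonneg hφ hc μ hσ hμ'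
  set D : ℝ → ℂ := fun t => measureFourier μ t - functionFourier φ t with hDdef
  have hDc : Continuous D := hμc.sub hφc
  have hD0 : ∀ t, σ ≤ |t| → D t = 0 := fun t ht => sub_eq_zero.2 (hμ' t ht)
  have hDzero : D 0 = 0 := by
    simp [hDdef, hφ.functionFourier_eq, measureFourier_eq_charFun]
  set h : ℝ → ℂ := fun x => ∫ t in (-σ)..σ, cexp (I * x * t) * D t with hh
  have him : ∀ x, (h x).im = 0 := fun x => by simpa [h, D] using (hpos x).2
  have hre : ∀ x, 0 ≤ (h x).re + 2 * Real.pi * φ x := fun x => by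
    simpa [h, D] using (hpos x).1
  let y : ℤ → ℝ := fun k => α + 2 * Real.pi * k / σ
  let G : ℝ → ℂ := fun t => cexp (I * α * t) * D t
  have hGc : Continuous G := by fun_prop
  have hσ' : (σ : ℂ) ≠ 0 := by exact_mod_cast hσ.ne'
  -- the phase `e^{iαt}` moves the lattice `α + (2π/σ)ℤ` to `(2π/σ)ℤ`
  have hexp : ∀ (k : ℤ) (t : ℝ),
      cexp (2 * Real.pi * I * k * t / σ) * cexp (I * α * t) = cexp (I * y k * t) := by
    intro k t
    rw [← Complex.exp_add]
    congr 1
    simp only [y]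
    push_cast
    field_simp
    ring
  have hG1 : G σ = 0 := by simp [G, hD0 σ (le_abs_self _)]
  have hG2 : G (-σ) = 0 := by simp [G, hD0 (-σ) (by simp [le_abs_self])]
  have hcoef : ∀ k : ℤ, ∫ t in (-σ)..σ, cexp (2 * Real.pi * I * k * t / σ) * G t = h (y k) := by
    intro k
    refine intervalIntegral.integral_congr fun t _ => ?_
    simp only [G]
    rw [← mul_assoc, hexp]
  have hyre : ∀ k, 0 ≤ (h (y k)).re := by
    intro k
    have h1 := hC k (y k)
    have h2 := hre (y k)
    simp only [y, sub_self] at h1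
    have : φ (y k) ≤ 0 := by simpa [y] using h1
    nlinarith [Real.pi_pos]
  have hyzero : ∀ k, h (y k) = 0 := by
    intro k
    apply Complex.ext
    · refine samples_eq_zero_of_nonneg hσ hGc (by simp [G, hDzero]) hG1 hG2 hyre (fun k => ?_) k
      rw [hcoef k]
      exact Complex.ext (by simp) (by simp [him])
    · exact him _
  have hcoef' : ∀ k : ℤ, ∫ t in (-σ)..σ, cexp (2 * Real.pi * I * k * t / σ) * (t * G t) = 0 := by
    intro k
    have hd := hasDerivAt_integral_exp_mul (T := σ) hDc (y k)
    rw [intervalIntegral.integral_const_mul] at hd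
    set d := ∫ t in (-σ)..σ, cexp (I * y k * t) * (t * D t) with hdd
    -- `I * d` is the derivative of the real-valued function `h` at `y k`
    have hd1 : (I * d).im = 0 := by
      have h1 : HasDerivAt (fun x => (h x).im) (I * d).im (y k) :=
        Complex.imCLM.hasFDerivAt.comp_hasDerivAt _ hd
      simp only [him] at h1
      exact h1.unique (hasDerivAt_const _ _)
    have hd2 : (I * d).re = 0 := by
      have h1 : HasDerivAt (fun x => (h x).re) (I * d).re (y k) :=
        Complex.reCLM.hasFDerivAt.comp_hasDerivAt _ hd
      have h2 : HasDerivAt (fun x => 2 * Real.pi * C * (x - y k) ^ 2) 0 (y k) := by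
        have := (((hasDerivAt_id (y k)).sub_const (y k)).pow 2).const_mul (2 * Real.pi * C)
        simpa using this
      have h3 := h1.add h2
      -- `h` vanishes at `y k` and is at least `-2πφ`, hence at least `-2πC (x - y k)²`
      have hmin : IsLocalMin (fun x => (h x).re + 2 * Real.pi * C * (x - y k) ^ 2) (y k) := by
        refine Eventually.of_forall fun x => ?_
        have e1 := hre x
        have e2 := mul_le_mul_of_nonneg_left (hC k x) Real.two_pi_pos.le
        simp only [hyzero k, sub_self, y] at *
        simp
        linarith
      simpa using hmin.hasDerivAt_eq_zero h3
    have hd3 : d = 0 := by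
      have : I * d = 0 := Complex.ext hd2 hd1
      simpa using this
    rw [← hd3]
    refine intervalIntegral.integral_congr fun t _ => ?_
    simp only [G]
    rw [← hexp]
    ring
  have hG := eq_zero_of_double_samples hσ hGc hG1 hG2 (fun k => (hcoef k).trans (hyzero k)) hcoef'
  rcases le_total σ |t| with ht | ht
  · exact (hμ' t ht).symm
  · have h1 := hG t (abs_le.1 ht)
    have h2 : D t = 0 := by simpa [G, Complex.exp_ne_zero] using h1
    exact (sub_eq_zero.1 h2).symm

/-! ### Densities on an interval -/

theorem essentialSupport_eq_Icc {a b : ℝ} (hab : a < b) {φ : ℝ → ℝ}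
    (h : ∀ x, φ x ≠ 0 ↔ x ∈ Set.Ioo a b) : essentialSupport φ = Set.Icc a b := by
  have hset : {t : ℝ | 0 < |φ t|} = Set.Ioo a b := by
    ext t; simp [abs_pos, h t]
  ext x
  simp only [essentialSupport, hset, Set.mem_ofPred_eq, Set.Ioo_inter_Ioo, Real.volume_Ioo,
    ENNReal.ofReal_pos, sub_pos, max_lt_iff, lt_min_iff, Set.mem_Icc]
  constructor
  · intro H
    constructor
    · exact le_of_forall_pos_lt_add fun ε hε => (H ε hε).1.2
    · refine le_of_forall_pos_lt_add fun ε hε => ?_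
      linarith [(H ε hε).2.1]
  · rintro ⟨h1, h2⟩ ε hε
    exact ⟨⟨by linarith, by linarith⟩, ⟨by linarith, hab⟩⟩

/-- Normalising a continuous function that is positive exactly on an open interval. -/
theorem isDensityOnInterval_div_integral {a b : ℝ} (hab : a < b) {φ : ℝ → ℝ} (hc : Continuous φ)
    (h0 : ∀ x, 0 ≤ φ x) (h : ∀ x, φ x ≠ 0 ↔ x ∈ Set.Ioo a b) :
    0 < ∫ x, φ x ∧ IsDensityOnInterval a b fun x => φ x / ∫ x, φ x := by
  have hsupp : Function.support φ = Set.Ioo a b := Set.ext h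
  have hint : Integrable φ := hc.integrable_of_hasCompactSupport <| by
    rw [HasCompactSupport, tsupport, hsupp, closure_Ioo hab.ne]
    exact isCompact_Icc
  have hpos : 0 < ∫ x, φ x := by
    rw [integral_pos_iff_support_of_nonneg h0 hint, hsupp]
    simpa using hab
  have hne : ∀ x, φ x / (∫ x, φ x) ≠ 0 ↔ x ∈ Set.Ioo a b := by
    intro x; rw [← h x]; simp [hpos.ne']
  have hc' : Continuous fun x => φ x / ∫ x, φ x := hc.div_const _
  exact ⟨hpos, ⟨hc'.measurable, hint.div_const _,
    Eventually.of_forall fun x => div_nonneg (h0 x) hpos.le,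
    by rw [integral_div, div_self hpos.ne']⟩, hc', hne, essentialSupport_eq_Icc hab hne⟩

/-- The bump `((x - a)(b - x))₊²` vanishes to second order at every point of the lattice
`a + ℤ(b - a)`. -/
theorem max_mul_sub_sq_le {a b L : ℝ} (hb : b = a + L) (hL : 0 < L) (k : ℤ) (x : ℝ) :
    max 0 ((x - a) * (b - x)) ^ 2 ≤ L ^ 2 * (x - (a + k * L)) ^ 2 := by
  rw [← mul_pow, sq_le_sq, abs_of_nonneg (le_max_left _ _), abs_mul, abs_of_pos hL]
  refine max_le (by positivity) ?_
  rcases le_or_gt ((x - a) * (b - x)) 0 with h | h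
  · exact h.trans (by positivity)
  have hx : 0 < x - a ∧ 0 < b - x := by
    rcases mul_pos_iff.1 h with h | h
    · exact h
    · linarith [h.1, h.2]
  rcases le_or_gt k 0 with hk | hk
  · have hk' : (k : ℝ) ≤ 0 := by exact_mod_cast hk
    have h1 : x - a ≤ |x - (a + k * L)| := le_trans (by nlinarith) (le_abs_self _)
    calc (x - a) * (b - x) ≤ |x - (a + k * L)| * L := by
          gcongr
          · exact hx.2.le
          · linarith [hx.1]
      _ = _ := mul_comm _ _
  · have hk' : (1 : ℝ) ≤ k := by exact_mod_cast hk
    have h1 : b - x ≤ |x - (a + k * L)| := le_trans (by nlinarith) (neg_le_abs _)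
    gcongr
    · exact hx.2.le
    · linarith [hx.2]

/-- A density vanishing to second order at both ends of the interval is determined. -/
theorem exists_density_determined (σ α : ℝ) (hσ : 0 < σ) :
    ∃ φ : ℝ → ℝ, IsDensityOnInterval α (α + 2 * Real.pi / σ) φ ∧
      ∀ g : ℝ → ℂ, IsCharacteristicFunction g →
        (∀ t : ℝ, σ < |t| → functionFourier φ t = g t) →
        ∀ t : ℝ, functionFourier φ t = g t := by
  have hL : 0 < 2 * Real.pi / σ := by positivity
  set b := α + 2 * Real.pi / σ with hb
  have hpos : ∀ x, 0 < (x - α) * (b - x) ↔ x ∈ Set.Ioo α b := by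
    intro x
    rw [mul_pos_iff, Set.mem_Ioo]
    constructor
    · rintro (h | h) <;> constructor <;> linarith [h.1, h.2]
    · rintro ⟨h1, h2⟩; left; constructor <;> linarith
  obtain ⟨hI, hdens⟩ := isDensityOnInterval_div_integral (a := α) (b := b) (by linarith)
    (φ := fun x => max 0 ((x - α) * (b - x)) ^ 2) (by fun_prop) (fun x => by positivity)
    (fun x => by rw [← hpos x]; simp)
  refine ⟨_, hdens, ?_⟩
  rintro g ⟨μ, hμ, hg⟩ hgt t
  rw [hg]
  refine measureFourier_eq_of_density_le_sq hσ hdens.density hdens.continuous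
    (α := α) (C := (2 * Real.pi / σ) ^ 2 / ∫ x, max 0 ((x - α) * (b - x)) ^ 2)
    (fun k x => ?_) μ (fun s hs => (hgt s hs).trans (hg s)) t
  have h1 := max_mul_sub_sq_le hb hL k x
  rw [div_mul_eq_mul_div, show α + 2 * Real.pi * k / σ = α + k * (2 * Real.pi / σ) by ring]
  gcongr

/-! ### A band-limited function with a single interval of positivity -/

/-- The function `sin (π |ξ|)` on `[-1, 1]`, extended by zero; truncating `|ξ|` at `1` does this
because `sin π = 0`. -/
noncomputable def sineTent (ξ : ℝ) : ℝ := Real.sin (Real.pi * min |ξ| 1)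

/-- The Fourier transform of `sineTent` in the normalisation `e^{-2πixξ}`, written as a real cosine
integral. Away from `x = ±1/2` it equals `2 (1 + cos 2πx) / (π (1 - 4x²))`. -/
noncomputable def sineTentFourier (x : ℝ) : ℝ :=
  2 * ∫ ξ in (0 : ℝ)..1, Real.sin (Real.pi * ξ) * Real.cos (2 * Real.pi * x * ξ)

theorem continuous_sineTent : Continuous sineTent := by unfold sineTent; fun_prop

theorem sineTent_eq_zero {ξ : ℝ} (h : 1 ≤ |ξ|) : sineTent ξ = 0 := by
  simp [sineTent, min_eq_right h]

theorem integrable_sineTent : Integrable fun ξ => (sineTent ξ : ℂ) := by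
  refine (continuous_ofReal.comp continuous_sineTent).integrable_of_hasCompactSupport ?_
  refine HasCompactSupport.intro (isCompact_Icc (a := (-1 : ℝ)) (b := 1)) fun ξ hξ => ?_
  have : 1 ≤ |ξ| := by
    by_contra h
    push Not at h
    exact hξ (abs_le.1 h.le)
  simp [sineTent_eq_zero this]

open FourierTransform in
theorem fourier_sineTent (x : ℝ) :
    𝓕 (fun ξ => (sineTent ξ : ℂ)) x = (sineTentFourier x : ℂ) := by
  have hc := continuous_sineTent
  rw [Real.fourier_real_eq_integral_exp_smul]
  set f : ℝ → ℂ := fun ξ => cexp (↑(-2 * Real.pi * ξ * x) * I) • (sineTent ξ : ℂ) with hf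
  have hfc : Continuous f := by fun_prop
  have h1 : ∫ ξ, f ξ = ∫ ξ in (-1 : ℝ)..1, f ξ := by
    rw [intervalIntegral.integral_of_le (by norm_num)]
    refine (setIntegral_eq_integral_of_forall_compl_eq_zero fun ξ hξ => ?_).symm
    have : 1 ≤ |ξ| := by
      by_contra h
      push Not at h
      exact hξ ⟨(abs_lt.1 h).1, (abs_lt.1 h).2.le⟩
    simp [f, sineTent_eq_zero this]
  have hi : ∀ a b, IntervalIntegrable f volume a b := fun a b => hfc.intervalIntegrable _ _
  have h2 : ∫ ξ in (-1 : ℝ)..0, f ξ = ∫ ξ in (0 : ℝ)..1, f (-ξ) := by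
    rw [intervalIntegral.integral_comp_neg]; simp
  rw [h1, ← intervalIntegral.integral_add_adjacent_intervals (hi (-1) 0) (hi 0 1), h2,
    ← intervalIntegral.integral_add
      ((by fun_prop : Continuous fun ξ => f (-ξ)).intervalIntegrable _ _) (hi _ _), sineTentFourier]
  rw [← intervalIntegral.integral_const_mul, ← intervalIntegral.integral_ofReal]
  refine intervalIntegral.integral_congr fun ξ hξ => ?_
  rw [Set.uIcc_of_le (by norm_num)] at hξ
  simp only [f, sineTent, abs_neg, abs_of_nonneg hξ.1, min_eq_left hξ.2, smul_eq_mul]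
  push_cast
  rw [← add_mul, show (-2 * Real.pi * -ξ * x * I : ℂ) = (2 * Real.pi * x * ξ) * I by ring,
    show (-2 * Real.pi * ξ * x * I : ℂ) = -(2 * Real.pi * x * ξ) * I by ring, ← Complex.two_cos]
  ring

theorem continuous_sineTentFourier : Continuous sineTentFourier := by
  unfold sineTentFourier
  refine continuous_const.mul ?_
  exact intervalIntegral.continuous_parametric_intervalIntegral_of_continuous' (by fun_prop) _ _

/-- The closed form of the transform, cleared of its denominator, from the antiderivative
`-cos (πξ) cos (2πxξ) - 2x sin (πξ) sin (2πxξ)`. -/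
theorem mul_sineTentFourier (x : ℝ) :
    Real.pi * (1 - 4 * x ^ 2) * sineTentFourier x = 2 * (1 + Real.cos (2 * Real.pi * x)) := by
  have h : ∀ ξ ∈ Set.uIcc (0 : ℝ) 1, HasDerivAt
      (fun ξ => -(Real.cos (Real.pi * ξ) * Real.cos (2 * Real.pi * x * ξ))
        - 2 * x * (Real.sin (Real.pi * ξ) * Real.sin (2 * Real.pi * x * ξ)))
      (Real.pi * (1 - 4 * x ^ 2) *
        (Real.sin (Real.pi * ξ) * Real.cos (2 * Real.pi * x * ξ))) ξ := by
    intro ξ _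
    have a1 : HasDerivAt (fun ξ => Real.pi * ξ) Real.pi ξ := by
      simpa using (hasDerivAt_id ξ).const_mul Real.pi
    have a2 : HasDerivAt (fun ξ => 2 * Real.pi * x * ξ) (2 * Real.pi * x) ξ := by
      simpa using (hasDerivAt_id ξ).const_mul (2 * Real.pi * x)
    have h3 := ((a1.cos.mul a2.cos).neg).sub ((a1.sin.mul a2.sin).const_mul (2 * x))
    refine h3.congr_deriv ?_
    ring
  have h2 := intervalIntegral.integral_eq_sub_of_hasDerivAt h
    (Continuous.intervalIntegrable (by fun_prop) _ _)
  rw [intervalIntegral.integral_const_mul] at h2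
  rw [sineTentFourier, mul_left_comm, h2]
  simp
  ring

/-- At `x = 1/2` the factor `1 - 4x²` of `mul_sineTentFourier` vanishes, so the value is computed
separately. -/
theorem sineTentFourier_half : sineTentFourier (1 / 2) = 0 := by
  have h : ∀ ξ ∈ Set.uIcc (0 : ℝ) 1, HasDerivAt
      (fun ξ => Real.sin (Real.pi * ξ) ^ 2 / (2 * Real.pi))
      (Real.sin (Real.pi * ξ) * Real.cos (2 * Real.pi * (1 / 2) * ξ)) ξ := by
    intro ξ _
    have a1 : HasDerivAt (fun ξ => Real.pi * ξ) Real.pi ξ := by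
      simpa using (hasDerivAt_id ξ).const_mul Real.pi
    refine ((a1.sin.pow 2).div_const (2 * Real.pi)).congr_deriv ?_
    have := Real.pi_ne_zero
    rw [show 2 * Real.pi * (1 / 2) * ξ = Real.pi * ξ by ring]
    field_simp
    simp
    ring
  rw [sineTentFourier, intervalIntegral.integral_eq_sub_of_hasDerivAt h
    (Continuous.intervalIntegrable (by fun_prop) _ _)]
  simp

theorem sineTentFourier_neg (x : ℝ) : sineTentFourier (-x) = sineTentFourier x := by
  simp [sineTentFourier]

theorem sineTentFourier_pos_iff (x : ℝ) :
    0 < sineTentFourier x ↔ x ∈ Set.Ioo (-(1 / 2)) (1 / 2) := by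
  have h := mul_sineTentFourier x
  have hpi := Real.pi_pos
  have hcos := Real.neg_one_le_cos (2 * Real.pi * x)
  rw [Set.mem_Ioo, ← abs_lt]
  rcases lt_trichotomy |x| (1 / 2) with hx | hx | hx
  · refine iff_of_true ?_ hx
    have h1 : 0 < 1 - 4 * x ^ 2 := by nlinarith [sq_abs x, abs_nonneg x]
    have h2 : 0 < 1 + Real.cos (2 * Real.pi * x) := by
      rw [← Real.cos_abs, abs_mul, abs_of_pos Real.two_pi_pos]
      have := Real.cos_lt_cos_of_nonneg_of_le_pi (x := 2 * Real.pi * |x|) (y := Real.pi)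
        (by positivity) le_rfl (by nlinarith)
      rw [Real.cos_pi] at this
      linarith
    have h3 : 0 < Real.pi * (1 - 4 * x ^ 2) := by positivity
    by_contra hc
    push Not at hc
    nlinarith
  · refine iff_of_false ?_ hx.not_lt
    rcases abs_eq (by norm_num : (0 : ℝ) ≤ 1 / 2) |>.1 hx with rfl | rfl
    · rw [sineTentFourier_half]; exact lt_irrefl _
    · rw [sineTentFourier_neg, sineTentFourier_half]; exact lt_irrefl _
  · refine iff_of_false (fun hW => ?_) hx.le.not_gt
    have h1 : 1 - 4 * x ^ 2 < 0 := by nlinarith [sq_abs x, abs_nonneg x]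
    have h3 : Real.pi * (1 - 4 * x ^ 2) < 0 := mul_neg_of_pos_of_neg hpi h1
    nlinarith

theorem abs_sineTentFourier_le (x : ℝ) : |sineTentFourier x| ≤ 4 * (1 + x ^ 2)⁻¹ := by
  rw [← div_eq_mul_inv, le_div_iff₀ (by positivity)]
  rcases le_or_gt (x ^ 2) 1 with hx | hx
  · have h1 : |sineTentFourier x| ≤ 2 := by
      rw [sineTentFourier, abs_mul, abs_two]
      have := intervalIntegral.norm_integral_le_of_norm_le_const (a := (0 : ℝ)) (b := 1) (C := 1)
        (f := fun ξ => Real.sin (Real.pi * ξ) * Real.cos (2 * Real.pi * x * ξ)) fun ξ _ => by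
          rw [norm_mul]
          exact mul_le_one₀ (Real.abs_sin_le_one _) (norm_nonneg _) (Real.abs_cos_le_one _)
      rw [Real.norm_eq_abs] at this
      simp only [sub_zero, abs_one, mul_one] at this
      linarith
    nlinarith [abs_nonneg (sineTentFourier x)]
  · have h := congrArg abs (mul_sineTentFourier x)
    rw [abs_mul, abs_mul, abs_of_pos Real.pi_pos, abs_of_neg (by linarith : 1 - 4 * x ^ 2 < 0),
      abs_of_nonneg (a := 2 * _) (by linarith [Real.neg_one_le_cos (2 * Real.pi * x)])] at h
    have h2 : 2 * (1 + Real.cos (2 * Real.pi * x)) ≤ 4 := by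
      linarith [Real.cos_le_one (2 * Real.pi * x)]
    have h3 : 1 + x ^ 2 ≤ Real.pi * -(1 - 4 * x ^ 2) := by nlinarith [Real.pi_gt_three]
    nlinarith [abs_nonneg (sineTentFourier x)]

theorem integrable_sineTentFourier : Integrable sineTentFourier :=
  (integrable_inv_one_add_sq.const_mul 4).mono'
    continuous_sineTentFourier.aestronglyMeasurable
    (Eventually.of_forall abs_sineTentFourier_le)

open FourierTransform in
/-- Fourier inversion: the transform of `sineTentFourier` is the even function `sineTent`. -/
theorem integral_exp_mul_sineTentFourier (s : ℝ) :
    ∫ x : ℝ, cexp (-(2 * Real.pi * I * s * x)) * (sineTentFourier x : ℂ) = sineTent s := by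
  have hF : 𝓕 (fun ξ => (sineTent ξ : ℂ)) = fun x => (sineTentFourier x : ℂ) :=
    funext fourier_sineTent
  have h := Continuous.fourierInv_fourier_eq (continuous_ofReal.comp continuous_sineTent)
    integrable_sineTent (by
      change Integrable (𝓕 (fun ξ => (sineTent ξ : ℂ)))
      rw [hF]
      exact integrable_sineTentFourier.ofReal)
  have h2 := congrFun h (-s)
  change 𝓕⁻ (𝓕 (fun ξ => (sineTent ξ : ℂ))) (-s) = (sineTent (-s) : ℂ) at h2
  rw [hF, Real.fourierInv_eq_fourier_neg, neg_neg, Real.fourier_real_eq_integral_exp_smul] at h2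
  rw [show sineTent s = sineTent (-s) by simp [sineTent], ← h2]
  refine integral_congr_ae (Eventually.of_forall fun x => ?_)
  simp only [smul_eq_mul]
  congr 2
  push_cast
  ring

/-! ### A density that is not determined -/

theorem integral_exp_mul_sineTentFourier_affine {L : ℝ} (hL : 0 < L) (α t : ℝ) :
    ∫ y : ℝ, cexp (-(I * t * y)) * (sineTentFourier ((y - α) / L - 1 / 2) : ℂ) =
      L * cexp (-(I * t * (α + L / 2))) * sineTent (t * L / (2 * Real.pi)) := by
  have hL' : (L : ℂ) ≠ 0 := by exact_mod_cast hL.ne'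
  have hpi : (Real.pi : ℂ) ≠ 0 := by exact_mod_cast Real.pi_ne_zero
  let f : ℝ → ℂ := fun u => cexp (-(I * t * (α + L / 2))) *
    (cexp (-(2 * Real.pi * I * (t * L / (2 * Real.pi) : ℝ) * u)) * (sineTentFourier u : ℂ))
  have h1 : ∀ y : ℝ, cexp (-(I * t * y)) * (sineTentFourier ((y - α) / L - 1 / 2) : ℂ) =
      f (y / L + -(α / L + 1 / 2)) := by
    intro y
    simp only [f]
    rw [← mul_assoc, ← Complex.exp_add]
    congr 2
    · push_cast
      field_simp
      ring
    · congr 1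
      ring
  simp only [h1]
  have h2 := Measure.integral_comp_div (fun u => f (u + -(α / L + 1 / 2))) L
  rw [h2, integral_add_right_eq_self f, integral_const_mul, integral_exp_mul_sineTentFourier,
    abs_of_pos hL, Complex.real_smul]
  ring

/-- The densities are the positive and the negative part of an affine image `H` of
`sineTentFourier`. They have the same mass since the transform of `H` vanishes at `0`, and their
transforms agree where that of `H` vanishes. -/
theorem exists_density_not_determined (σ α : ℝ) (hσ : 0 < σ) :
    ∃ φ : ℝ → ℝ, IsDensityOnInterval α (α + 2 * Real.pi / σ) φ ∧
      ∃ g : ℝ → ℂ, IsCharacteristicFunction g ∧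
        (∀ t : ℝ, σ < |t| → functionFourier φ t = g t) ∧
        ∃ t : ℝ, functionFourier φ t ≠ g t := by
  have hL : 0 < 2 * Real.pi / σ := by positivity
  set L := 2 * Real.pi / σ with hLdef
  let H : ℝ → ℝ := fun y => sineTentFourier ((y - α) / L - 1 / 2)
  have hHc : Continuous H := by
    have := continuous_sineTentFourier
    fun_prop
  have hHi : Integrable H := by
    have := (integrable_sineTentFourier.comp_sub_right (α / L + 1 / 2)).comp_div hL.ne'
    refine this.congr (Eventually.of_forall fun y => ?_)
    simp only [H]
    congr 1
    ring
  have hHpos : ∀ y, 0 < H y ↔ y ∈ Set.Ioo α (α + L) := by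
    intro y
    rw [sineTentFourier_pos_iff, Set.mem_Ioo, Set.mem_Ioo, ← sub_pos, sub_neg_eq_add,
      sub_add_cancel, div_pos_iff_of_pos_right hL, sub_pos, sub_lt_iff_lt_add, add_halves,
      div_lt_iff₀ hL, one_mul, sub_lt_iff_lt_add']
  have hHF : ∀ t : ℝ, ∫ y : ℝ, cexp (-(I * t * y)) * (H y : ℂ) =
      L * cexp (-(I * t * (α + L / 2))) * sineTent (t / σ) := by
    intro t
    have := integral_exp_mul_sineTentFourier_affine hL α t
    rw [show t * L / (2 * Real.pi) = t / σ by rw [hLdef]; field_simp] at this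
    exact this
  have hH0 : ∫ y, H y = 0 := by
    have := hHF 0
    simp only [ofReal_zero, mul_zero, zero_mul, neg_zero, Complex.exp_zero, one_mul, zero_div]
      at this
    rw [integral_complex_ofReal] at this
    simpa [sineTent] using this
  obtain ⟨hI, hdens⟩ := isDensityOnInterval_div_integral (a := α) (b := α + L) (by linarith)
    (φ := fun y => max (H y) 0) (by fun_prop) (fun y => le_max_right _ _)
    (fun y => by rw [← hHpos y]; simp)
  set J := ∫ y, max (H y) 0 with hJ
  have hsub : ∀ y, max (H y) 0 - max (-H y) 0 = H y := fun y => by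
    rcases le_total 0 (H y) with h | h <;> simp [h]
  have hρ : IsProbabilityDensity fun y => max (-H y) 0 / J := by
    refine ⟨Continuous.measurable (by fun_prop), hHi.neg.pos_part.div_const _,
      Eventually.of_forall fun y => div_nonneg (le_max_right _ _) hI.le, ?_⟩
    have h1 := integral_sub hHi.pos_part hHi.neg.pos_part
    simp only [Pi.neg_apply, hsub, hH0] at h1
    rw [integral_div, div_eq_one_iff_eq hI.ne', hJ]
    linarith
  have hdiff : ∀ t, functionFourier (fun y => max (H y) 0 / J) t
      - functionFourier (fun y => max (-H y) 0 / J) t =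
      L * cexp (-(I * t * (α + L / 2))) * sineTent (t / σ) / J := by
    intro t
    have hexp : ∀ f : ℝ → ℝ, Integrable f →
        Integrable fun y : ℝ => cexp (-(I * t * y)) * (f y : ℂ) := by
      intro f hf
      refine hf.ofReal.bdd_mul (c := 1) (by fun_prop) (Eventually.of_forall fun y => ?_)
      rw [Complex.norm_exp]; simp
    rw [functionFourier, functionFourier,
      ← integral_sub (hexp _ hdens.density.integrable) (hexp _ hρ.integrable), ← hHF,
      ← integral_div]
    refine integral_congr_ae (Eventually.of_forall fun y => ?_)
    have := hsub y
    simp only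
    rw [← mul_sub, ← ofReal_sub, ← sub_div, this, ofReal_div, mul_div_assoc]
  refine ⟨_, hdens, functionFourier fun y => max (-H y) 0 / J,
    ⟨_, hρ.isProbabilityMeasure, hρ.functionFourier_eq⟩, fun t ht => ?_, σ / 2, fun h => ?_⟩
  · have : sineTent (t / σ) = 0 :=
      sineTent_eq_zero (by rw [abs_div, abs_of_pos hσ, le_div_iff₀ hσ]; linarith)
    rw [← sub_eq_zero, hdiff, this]
    simp
  -- `σ / 2` corresponds to the maximum `sineTent (1 / 2) = 1`
  · have h1 := hdiff (σ / 2)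
    have h2 : sineTent (σ / 2 / σ) = 1 := by
      rw [show σ / 2 / σ = 1 / 2 by field_simp, sineTent, abs_of_pos (by norm_num),
        min_eq_left (by norm_num), mul_one_div, Real.sin_pi_div_two]
    rw [h, sub_self, h2] at h1
    have hL' : (L : ℂ) ≠ 0 := by exact_mod_cast hL.ne'
    have hJ' : (J : ℂ) ≠ 0 := by exact_mod_cast hI.ne'
    rw [ofReal_one, mul_one, eq_comm] at h1
    exact div_ne_zero (mul_ne_zero hL' (Complex.exp_ne_zero _)) hJ' h1

theorem proposition1p8 (σ α : ℝ) (hσ : 0 < σ) :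
    (∃ φ : ℝ → ℝ, IsDensityOnInterval α (α + 2 * Real.pi / σ) φ ∧
      ∀ g : ℝ → ℂ, IsCharacteristicFunction g →
        (∀ t : ℝ, σ < |t| → functionFourier φ t = g t) →
        ∀ t : ℝ, functionFourier φ t = g t) ∧
    (∃ φ : ℝ → ℝ, IsDensityOnInterval α (α + 2 * Real.pi / σ) φ ∧
      ∃ g : ℝ → ℂ, IsCharacteristicFunction g ∧
        (∀ t : ℝ, σ < |t| → functionFourier φ t = g t) ∧
        ∃ t : ℝ, functionFourier φ t ≠ g t) :=
  ⟨exists_density_determined σ α hσ, exists_density_not_determined σ α hσ⟩
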